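/- Let $\mu\in\mathbb R^n$, let $\Sigma$ be a diagonal positive definite matrix, let $\mathbf x_0\sim\mathcal N(\mu,\Sigma)$, let $\mathbb U^n=(0,1)^n$, and let $\psi:\mathbb R^n\to\mathbb U^n$, $\psi_i(\mathbf x)=c(x_i;\mu_i,\Sigma_{ii})$, where $c(\cdot;\mu_i,\Sigma_{ii})$ is the cumulative distribution function of $\mathcal N(\mu_i,\Sigma_{ii})$. Let $\hat f:[0,1]^n\to\mathbb R^n$ be a vector field in the coordinates $\mathbf u=\psi(\mathbf x)$ such that $\hat f_i(\mathbf u)=0$ whenever $u_i\in\{0,1\}$, and suppose that $\hat f$ extends, for some $r>1$, to a holomorphic map on the complex polydisk $\{\mathbf w\in\mathbb C^n : |w_i-\tfrac12|<r \text{ for all } i\}$. Let $\hat\phi(\mathbf x,t)$, $t\in\mathbb R$, be the flow on $\mathbb R^n$ of the state-space vector field that corresponds to $\hat f$, i.e. of $\dot x_i=\hat f_i(\psi(\mathbf x))/\psi_i'(x_i)$, where $\psi_i'$ is the density of $\mathcal N(\mu_i,\Sigma_{ii})$. Let $R\subset\mathbb R^n$ be a hyperrectangle, $\tau\ge 0$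 and $k\ge 0$ an integer. For $t\in\mathbb R$ put $$\Omega(t)=\psi\big(\{\mathbf x : \hat\phi(\mathbf x,\tau-t)\in R\}\big)\subset\mathbb U^n,\qquad V_\Omega(t)=\mathrm{vol}(\Omega(t)),$$ $$\tilde V^k_\Omega(t)=\sum_{j=0}^{k}\frac{d^jV_\Omega}{dt^j}(\tau)\,\frac{(t-\tau)^j}{j!},\qquad r^k(t)=V_\Omega(t)-\tilde V^k_\Omega(t),$$ and let $\Gamma_0=1$, $\Gamma_{j+1}=\nabla\cdot(\Gamma_j\hat f)$ on $\mathbb U^n$. Then $V_\Omega$ is $k+1$ times continuously differentiable, and the following holds. Let $t\in[0,\tau]$, let $\mathcal R[t,\tau]\subseteq\mathbb U^n$ be a set that contains $\Omega(s)$ for every $s\in[t,\tau]$, and let $\delta_k\ge 0$ be a real number with $$\delta_k\ \ge\ \sup_{\mathbf u\in\mathcal R[t,\tau]}(-1)^{k+1}\Gamma_{k+1}(\mathbf u).$$ Then $$r^k(t)\ \le\ \delta_k\,\mathrm{vol}(\mathcal R[t,\tau])\,\frac{|t-\tau|^{k+1}}{(k+1)!}.$$ In particular, if $t=0$, then $$P(\hat\phi(\mathbf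 x_0,\tau)\in R)\ \le\ \tilde V^k_\Omega(0)+\delta_k\,\mathrm{vol}(\mathcal R[0,\tau])\,\frac{\tau^{k+1}}{(k+1)!}.$$ -/

import Mathlib

open MeasureTheory ProbabilityTheory Set
open scoped NNReal Nat

/-- The open unit cube `(0,1)^n`. -/
def unitCube (n : ℕ) : Set (Fin n → ℝ) :=
  {u | ∀ i, 0 < u i ∧ u i < 1}

/-- The closed unit cube `[0,1]^n`. -/
def closedUnitCube (n : ℕ) : Set (Fin n → ℝ) :=
  {u | ∀ i, 0 ≤ u i ∧ u i ≤ 1}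

/-- The normal distribution on `ℝ^n` with mean `m` and diagonal covariance `diag v`. -/
noncomputable def diagGaussian {n : ℕ} (m : Fin n → ℝ) (v : Fin n → ℝ≥0) :
    Measure (Fin n → ℝ) :=
  Measure.pi fun i => gaussianReal (m i) (v i)

/-- The map `ψ : ℝ^n → (0,1)^n` applying to each coordinate the cumulative distribution
function of the corresponding marginal of the initial distribution. -/
noncomputable def cdfMap {n : ℕ} (m : Fin n → ℝ) (v : Fin n → ℝ≥0) (x : Fin n → ℝ) :
    Fin n → ℝ :=
  fun i => cdf (gaussianReal (m i) (v i)) (x i)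

/-- The state-space vector field whose expression in the coordinates `u = ψ x` is `f`:
since `∂ψ_i/∂x_i` is the `i`-th marginal density, the chain rule
`f_i (ψ x) = pdf_i (x_i) * ẋ_i` determines `ẋ`. -/
noncomputable def stateField {n : ℕ} (m : Fin n → ℝ) (v : Fin n → ℝ≥0)
    (f : (Fin n → ℝ) → (Fin n → ℝ)) (x : Fin n → ℝ) : Fin n → ℝ :=
  fun i => f (cdfMap m v x) i / gaussianPDFReal (m i) (v i) (x i)

/-- `Φ x t` is the position at time `t ∈ ℝ` of the solution of `ẋ = F x` that starts
at `x` at time `0`. -/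
def IsFlowOf {n : ℕ} (F : (Fin n → ℝ) → (Fin n → ℝ))
    (Φ : (Fin n → ℝ) → ℝ → (Fin n → ℝ)) : Prop :=
  ∀ x, Φ x 0 = x ∧ ∀ t, HasDerivAt (Φ x) (F (Φ x t)) t

/-- The boundary conditions: `f_i (u) = 0` at the points of the closed cube where
`u_i = 0` or `u_i = 1`. -/
def BoundaryConditions {n : ℕ} (f : (Fin n → ℝ) → (Fin n → ℝ)) : Prop :=
  ∀ u ∈ closedUnitCube n, ∀ i, (u i = 0 ∨ u i = 1) → f u i = 0

/-- The complex polydisk with centre `w₀` and radius `r`. -/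
def polydisk {n : ℕ} (r : ℝ) (w₀ : Fin n → ℂ) : Set (Fin n → ℂ) :=
  {w | ∀ i, ‖w i - w₀ i‖ < r}

/-- `f` has an analytic continuation that is holomorphic on a polydisk of some radius
`r > 1` centred at `(1/2, …, 1/2)`. -/
def HasHolomorphicContinuation {n : ℕ} (f : (Fin n → ℝ) → (Fin n → ℝ)) : Prop :=
  ∃ r : ℝ, 1 < r ∧ ∃ g : (Fin n → ℂ) → (Fin n → ℂ),
    DifferentiableOn ℂ g (polydisk r fun _ => 1 / 2) ∧
    ∀ u ∈ closedUnitCube n, g (fun i => (u i : ℂ)) = fun i => (f u i : ℂ)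

/-- A hyperrectangle: a product of intervals, each of them open, closed or half-open,
bounded or not. -/
def IsHyperrectangle {n : ℕ} (R : Set (Fin n → ℝ)) : Prop :=
  ∃ I : Fin n → Set ℝ, (∀ i, (I i).OrdConnected) ∧ R = Set.univ.pi I

/-- The control mass in state space: the states that reach `R` after the time `τ - t`. -/
def stateControlMass {n : ℕ} (Φ : (Fin n → ℝ) → ℝ → (Fin n → ℝ))
    (R : Set (Fin n → ℝ)) (τ t : ℝ) : Set (Fin n → ℝ) :=
  {x | Φ x (τ - t) ∈ R}

/-- The control mass `Ω(t)` in the unit cube. -/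
def controlMass {n : ℕ} (m : Fin n → ℝ) (v : Fin n → ℝ≥0)
    (Φ : (Fin n → ℝ) → ℝ → (Fin n → ℝ)) (R : Set (Fin n → ℝ)) (τ t : ℝ) :
    Set (Fin n → ℝ) :=
  cdfMap m v '' stateControlMass Φ R τ t

/-- The volume function `V_Ω(t; τ)`: the Lebesgue measure of the control mass `Ω(t)`. -/
noncomputable def volumeFn {n : ℕ} (m : Fin n → ℝ) (v : Fin n → ℝ≥0)
    (Φ : (Fin n → ℝ) → ℝ → (Fin n → ℝ)) (R : Set (Fin n → ℝ)) (τ t : ℝ) : ℝ :=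
  volume.real (controlMass m v Φ R τ t)

/-- The divergence of a vector field on `ℝ^n`. -/
noncomputable def divergence {n : ℕ} (F : (Fin n → ℝ) → (Fin n → ℝ)) (u : Fin n → ℝ) : ℝ :=
  ∑ i, fderiv ℝ (fun w => F w i) u (Pi.single i 1)

/-- The functions `Γ_0 = 1`, `Γ_{k+1} = ∇ · (Γ_k f)`. -/
noncomputable def gammaFn {n : ℕ} (f : (Fin n → ℝ) → (Fin n → ℝ)) :
    ℕ → (Fin n → ℝ) → ℝ
  | 0 => fun _ => 1
  | k + 1 => divergence fun u => gammaFn f k u • f u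

/-- `𝓡` is a tube set for the time interval `[t₁, t₂]`: a subset of the unit cube that
contains `Ω(s)` for all `s ∈ [t₁, t₂]`. -/
def IsTube {n : ℕ} (Ω : ℝ → Set (Fin n → ℝ)) (t₁ t₂ : ℝ) (𝓡 : Set (Fin n → ℝ)) : Prop :=
  𝓡 ⊆ unitCube n ∧ ∀ s ∈ Icc t₁ t₂, Ω s ⊆ 𝓡

/-- The degree-`k` Taylor polynomial of `V` about `τ`, evaluated at `t`. -/
noncomputable def taylorPoly (V : ℝ → ℝ) (k : ℕ) (τ t : ℝ) : ℝ :=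
  ∑ j ∈ Finset.range (k + 1), iteratedDeriv j V τ * (t - τ) ^ j / (j ! : ℝ)

/-- The remainder of the degree-`k` Taylor expansion of `V` about `τ`, evaluated at `t`. -/
noncomputable def taylorRemainder (V : ℝ → ℝ) (k : ℕ) (τ t : ℝ) : ℝ :=
  V t - taylorPoly V k τ t

/-!
In the coordinates `u = ψ x` the flow becomes a flow `ϕ` of `f` on the open unit cube, and the
probability integral transform (`map_cdf_gaussianReal`) turns the law of the initial state into
Lebesgue measure. The control mass is `Ω(t) = ϕ_{t-τ} (ψ '' R)`, so its volume at time `0` is the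
probability that is to be estimated (`controlMass_eq_image_cubeFlow`, `volume_image_cdfMap`).

The heart of the proof is the transport theorem `IsCubeFlow.hasDerivAt_setIntegral_image`:
`d/dt ∫_{ϕ_t S} g = ∫_{ϕ_t S} ∇ · (g f)` for every measurable subset `S` of the cube. Applied to
`g = Γ_j` for `j = 0, 1, …` it gives `V_Ω^(j)(t) = ∫_{Ω(t)} Γ_j`. Hence `V_Ω` is smooth, and the
Lagrange form of the remainder, together with the inclusion of `Ω(s)` in the tube set, gives the
bound.

By the group law it is enough to differentiate at `t = 0`. There the smoothness of the flow in the
initial point is not needed. Grönwall's inequality shows that the flow is Lipschitz, and that the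
remainder `ϕ_s u - u - s f(u)` is Lipschitz in `u` with a constant `O(s²)`
(`IsCubeFlow.exists_lipschitzOnWith_remainder`). By Rademacher's theorem `ϕ_s` is differentiable
almost everywhere, and at the points of differentiability its derivative is `1 + s Df + O(s²)`, with
determinant `1 + s ∇ · f + o(s)`, uniformly in `u`. The change of variables formula then gives the
derivative.

All bounds are uniform because `f` is smooth on a neighbourhood of the closed cube. This follows
from the holomorphic continuation, since a complex differentiable map of several variables is smooth
(`DifferentiableOn.contDiffOn_of_finiteDimensional`).
-/

/-! ### Smoothness of holomorphic maps of several variables -/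

open Complex Metric in
/-- The directional derivatives of a holomorphic map of several variables are holomorphic: locally
they are given by Cauchy's formula on a circle in the complex line spanned by the direction, and
this integral may be differentiated under the integral sign. -/
theorem differentiableOn_fderiv_apply {E F : Type*} [NormedAddCommGroup E] [NormedSpace ℂ E]
    [FiniteDimensional ℂ E] [NormedAddCommGroup F] [NormedSpace ℂ F] [FiniteDimensional ℂ F]
    {g : E → F} {U : Set E} (hU : IsOpen U) (hg : DifferentiableOn ℂ g U) (v : E) :
    DifferentiableOn ℂ (fun w => fderiv ℂ g w v) U := by
  have : CompleteSpace F := FiniteDimensional.complete ℂ F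
  borelize E
  borelize F
  intro w₀ hw₀
  obtain ⟨ε₁, hε₁, hball⟩ := Metric.isOpen_iff.1 hU w₀ hw₀
  obtain ⟨ε₂, hε₂, hbd⟩ := Metric.continuousAt_iff.1
    (hg.continuousOn.continuousAt (hU.mem_nhds hw₀)) 1 one_pos
  obtain ⟨ε, hε, hε1, hε2⟩ : ∃ ε > 0, 3 * ε ≤ ε₁ ∧ 3 * ε ≤ ε₂ :=
    ⟨min ε₁ ε₂ / 3, by positivity, by linarith [min_le_left ε₁ ε₂],
      by linarith [min_le_right ε₁ ε₂]⟩
  have hd : ∀ p ∈ ball w₀ (3 * ε), DifferentiableAt ℂ g p := fun p hp =>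
    hg.differentiableAt (hU.mem_nhds (hball (ball_subset_ball hε1 hp)))
  -- Cauchy's estimate on balls of radius `ε`.
  have hfd : ∀ p ∈ ball w₀ (2 * ε), ‖fderiv ℂ g p‖ ≤ 2 / ε := by
    intro p hp
    have hsub : ball p ε ⊆ ball w₀ (3 * ε) := by
      apply ball_subset_ball'
      rw [mem_ball] at hp; linarith
    refine norm_fderiv_le_div_of_mapsTo_ball (R₂ := 2)
      (fun q hq => (hd q (hsub hq)).differentiableWithinAt) ?_ hε
    intro q hq
    have h1 := hbd (ball_subset_ball hε2 (hsub hq))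
    have h2 := hbd (ball_subset_ball hε2 (hsub (mem_ball_self hε)))
    rw [mem_closedBall]
    have := dist_triangle_right (g q) (g p) (g w₀)
    linarith
  obtain ⟨ρ, hρ, hρv⟩ : ∃ ρ > 0, ρ * ‖v‖ < ε := by
    refine ⟨ε / (‖v‖ + 1), by positivity, ?_⟩
    rw [div_mul_eq_mul_div, div_lt_iff₀ (by positivity)]
    nlinarith [norm_nonneg v]
  have hmem : ∀ w ∈ ball w₀ ε, ∀ z ∈ closedBall (0 : ℂ) ρ, w + z • v ∈ ball w₀ (2 * ε) := by
    intro w hw z hz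
    rw [mem_ball, dist_eq_norm] at hw ⊢
    rw [mem_closedBall, dist_zero_right] at hz
    have h1 : ‖z • v‖ ≤ ρ * ‖v‖ := by rw [norm_smul]; gcongr
    calc ‖w + z • v - w₀‖ = ‖(w - w₀) + z • v‖ := by congr 1; abel
      _ ≤ ‖w - w₀‖ + ‖z • v‖ := norm_add_le _ _
      _ < 2 * ε := by linarith
  have hsub23 : ball w₀ (2 * ε) ⊆ ball w₀ (3 * ε) := ball_subset_ball (by linarith)
  have hline : ∀ w ∈ ball w₀ ε, ∀ z ∈ closedBall (0 : ℂ) ρ,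
      HasDerivAt (fun z : ℂ => g (w + z • v)) (fderiv ℂ g (w + z • v) v) z := by
    intro w hw z hz
    have h1 : HasDerivAt (fun z : ℂ => w + z • v) v z := by
      simpa using ((hasDerivAt_id z).smul_const v).const_add w
    exact (hd _ (hsub23 (hmem w hw z hz))).hasFDerivAt.comp_hasDerivAt z h1
  have hcauchy : ∀ w ∈ ball w₀ ε, fderiv ℂ g w v =
      (2 * Real.pi * I : ℂ)⁻¹ • ∮ z in C(0, ρ), (1 / (z - 0) ^ 2) • g (w + z • v) := by
    intro w hw
    have h1 := DifferentiableOn.deriv_eq_smul_circleIntegral (f := fun z : ℂ => g (w + z • v)) hρ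
      (c := 0) (fun z hz => (hline w hw z hz).differentiableAt.differentiableWithinAt)
    rw [h1, (hline w hw 0 (by simp [hρ.le])).deriv, smul_smul, inv_mul_cancel₀ two_pi_I_ne_zero]
    simp
  have hcm : ∀ θ, circleMap 0 ρ θ ∈ closedBall (0 : ℂ) ρ := fun θ =>
    circleMap_mem_closedBall 0 hρ.le θ
  have hcm0 : ∀ θ, circleMap 0 ρ θ ≠ 0 := fun θ => circleMap_ne_center hρ.ne'
  have hkcont : Continuous fun θ : ℝ =>
      deriv (circleMap 0 ρ) θ * (1 / (circleMap 0 ρ θ - 0) ^ 2) := by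
    simp only [deriv_circleMap, sub_zero]
    refine ((continuous_circleMap 0 ρ).mul continuous_const).mul
      (Continuous.div continuous_const ((continuous_circleMap 0 ρ).pow 2) fun θ => ?_)
    exact pow_ne_zero _ (hcm0 θ)
  have hgcont : ∀ w ∈ ball w₀ ε, Continuous fun θ : ℝ => g (w + circleMap 0 ρ θ • v) := by
    intro w hw
    refine continuous_iff_continuousAt.2 fun θ => ?_
    exact ContinuousAt.comp (f := fun θ : ℝ => w + circleMap 0 ρ θ • v)
      (hd _ (hsub23 (hmem w hw _ (hcm θ)))).continuousAt
      (((continuous_circleMap 0 ρ).smul continuous_const).const_add w).continuousAt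
  have hFcont : ∀ w ∈ ball w₀ ε, Continuous fun θ : ℝ =>
      (deriv (circleMap 0 ρ) θ * (1 / (circleMap 0 ρ θ - 0) ^ 2)) • g (w + circleMap 0 ρ θ • v) :=
    fun w hw => hkcont.smul (hgcont w hw)
  have hnhds : ball w₀ ε ∈ nhds w₀ := ball_mem_nhds _ hε
  have hint := intervalIntegral.hasFDerivAt_integral_of_dominated_of_fderiv_le (𝕜 := ℂ)
    (μ := volume) (a := 0) (b := 2 * Real.pi) (x₀ := w₀)
    (F := fun w θ => (deriv (circleMap 0 ρ) θ * (1 / (circleMap 0 ρ θ - 0) ^ 2)) •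
      g (w + circleMap 0 ρ θ • v))
    (F' := fun w θ => (deriv (circleMap 0 ρ) θ * (1 / (circleMap 0 ρ θ - 0) ^ 2)) •
      fderiv ℂ g (w + circleMap 0 ρ θ • v))
    (bound := fun θ => ‖deriv (circleMap 0 ρ) θ * (1 / (circleMap 0 ρ θ - 0) ^ 2)‖ * (2 / ε))
    hnhds
    (Filter.eventually_of_mem hnhds fun w hw => (hFcont w hw).aestronglyMeasurable)
    ((hFcont w₀ (mem_ball_self hε)).intervalIntegrable _ _)
    (by
      refine hkcont.aestronglyMeasurable.smul ?_
      have : Measurable fun θ : ℝ => fderiv ℂ g (w₀ + circleMap 0 ρ θ • v) :=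
        (measurable_fderiv ℂ g).comp
          (((continuous_circleMap 0 ρ).smul continuous_const).const_add w₀).measurable
      have : SecondCountableTopology (E →L[ℂ] F) := by
        have : FiniteDimensional ℂ (E →L[ℂ] F) := inferInstance
        have := FiniteDimensional.proper ℂ (E →L[ℂ] F)
        infer_instance
      exact Measurable.aestronglyMeasurable ‹_›)
    (by
      refine Filter.Eventually.of_forall fun θ _ w hw => ?_
      rw [norm_smul]
      gcongr
      exact hfd _ (hmem w hw _ (hcm θ)))
    ((hkcont.norm.mul continuous_const).intervalIntegrable _ _)
    (by
      refine Filter.Eventually.of_forall fun θ _ w hw => ?_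
      refine HasFDerivAt.const_smul ?_ _
      exact (hasFDerivAt_comp_add_right _).2 (hd _ (hsub23 (hmem w hw _ (hcm θ)))).hasFDerivAt)
  refine DifferentiableAt.differentiableWithinAt ?_
  refine (hint.differentiableAt.const_smul (2 * Real.pi * I : ℂ)⁻¹).congr_of_eventuallyEq ?_
  filter_upwards [hnhds] with w hw
  rw [hcauchy w hw]
  simp only [circleIntegral, smul_smul, Pi.smul_apply]

theorem DifferentiableOn.contDiffOn_of_finiteDimensional {E F : Type*} [NormedAddCommGroup E]
    [NormedSpace ℂ E] [FiniteDimensional ℂ E] [NormedAddCommGroup F] [NormedSpace ℂ F]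
    [FiniteDimensional ℂ F] {g : E → F} {U : Set E} (hU : IsOpen U)
    (hg : DifferentiableOn ℂ g U) : ContDiffOn ℂ (⊤ : ℕ∞) g U := by
  rw [contDiffOn_infty]
  intro k
  induction k generalizing g with
  | zero => exact contDiffOn_zero.2 hg.continuousOn
  | succ k ih =>
    push_cast
    refine (contDiffOn_succ_iff_fderiv_apply hU.uniqueDiffOn).2 ⟨hg, by simp, fun y => ?_⟩
    refine (ih (differentiableOn_fderiv_apply hU hg y)).congr fun x hx => ?_
    rw [fderivWithin_of_isOpen hU hx]

/-! ### Functions that are smooth up to the boundary of the unit cube -/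

theorem unitCube_eq_pi (n : ℕ) : unitCube n = Set.univ.pi fun _ => Ioo (0 : ℝ) 1 := by
  ext u; simp [unitCube]

theorem isOpen_unitCube (n : ℕ) : IsOpen (unitCube n) := by
  rw [unitCube_eq_pi]
  exact isOpen_set_pi finite_univ fun _ _ => isOpen_Ioo

theorem closedUnitCube_eq_pi (n : ℕ) :
    closedUnitCube n = Set.univ.pi fun _ => Icc (0 : ℝ) 1 := by
  ext u; simp only [closedUnitCube, Set.mem_pi, mem_univ, true_imp_iff, mem_Icc]; rfl

theorem unitCube_subset_closedUnitCube (n : ℕ) : unitCube n ⊆ closedUnitCube n :=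
  fun _ hu i => ⟨(hu i).1.le, (hu i).2.le⟩

theorem isCompact_closedUnitCube (n : ℕ) : IsCompact (closedUnitCube n) := by
  rw [closedUnitCube_eq_pi]
  exact isCompact_univ_pi fun _ => isCompact_Icc

theorem convex_unitCube (n : ℕ) : Convex ℝ (unitCube n) := by
  rw [unitCube_eq_pi]
  exact convex_pi fun _ _ => convex_Ioo 0 1

theorem volume_unitCube (n : ℕ) : volume (unitCube n) = 1 := by
  rw [unitCube_eq_pi, Real.volume_pi_Ioo]
  simp

/-- `h` is smooth up to the boundary of the unit cube: on the open cube it agrees with a map that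
is smooth on an open neighbourhood of the closed cube. The values of `h` off the open cube play no
role. -/
def SmoothUpToBoundary {n : ℕ} {G : Type*} [NormedAddCommGroup G] [NormedSpace ℝ G]
    (h : (Fin n → ℝ) → G) : Prop :=
  ∃ W : Set (Fin n → ℝ), IsOpen W ∧ closedUnitCube n ⊆ W ∧
    ∃ H : (Fin n → ℝ) → G, ContDiffOn ℝ (⊤ : ℕ∞) H W ∧ EqOn h H (unitCube n)

namespace SmoothUpToBoundary

variable {n : ℕ} {G : Type*} [NormedAddCommGroup G] [NormedSpace ℝ G]
  {G' : Type*} [NormedAddCommGroup G'] [NormedSpace ℝ G'] {h : (Fin n → ℝ) → G}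

theorem of_contDiff (hh : ContDiff ℝ (⊤ : ℕ∞) h) : SmoothUpToBoundary h :=
  ⟨univ, isOpen_univ, subset_univ _, h, hh.contDiffOn, fun _ _ => rfl⟩

theorem prodMk {h' : (Fin n → ℝ) → G'} (hh : SmoothUpToBoundary h)
    (hh' : SmoothUpToBoundary h') : SmoothUpToBoundary fun u => (h u, h' u) := by
  obtain ⟨W, hW, hWc, H, hH, he⟩ := hh
  obtain ⟨W', hW', hWc', H', hH', he'⟩ := hh'
  exact ⟨W ∩ W', hW.inter hW', subset_inter hWc hWc', fun u => (H u, H' u),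
    (hH.mono inter_subset_left).prodMk (hH'.mono inter_subset_right),
    fun u hu => by simp only [he hu, he' hu]⟩

theorem comp_left {c : G → G'} (hc : ContDiff ℝ (⊤ : ℕ∞) c) (hh : SmoothUpToBoundary h) :
    SmoothUpToBoundary fun u => c (h u) := by
  obtain ⟨W, hW, hWc, H, hH, he⟩ := hh
  exact ⟨W, hW, hWc, fun u => c (H u), hc.comp_contDiffOn hH, fun u hu => by simp only [he hu]⟩

theorem differentiableAt (hh : SmoothUpToBoundary h) {u : Fin n → ℝ} (hu : u ∈ unitCube n) :
    DifferentiableAt ℝ h u := by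
  obtain ⟨W, hW, hWc, H, hH, he⟩ := hh
  have h1 : DifferentiableAt ℝ H u :=
    (hH.contDiffAt (hW.mem_nhds (hWc (unitCube_subset_closedUnitCube n hu)))).differentiableAt
      (by simp)
  exact h1.congr_of_eventuallyEq (he.eventuallyEq_of_mem ((isOpen_unitCube n).mem_nhds hu))

theorem fderiv (hh : SmoothUpToBoundary h) : SmoothUpToBoundary (fderiv ℝ h) := by
  obtain ⟨W, hW, hWc, H, hH, he⟩ := hh
  refine ⟨W, hW, hWc, _root_.fderiv ℝ H, hH.fderiv_of_isOpen hW (by simp), fun u hu => ?_⟩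
  exact (he.eventuallyEq_of_mem ((isOpen_unitCube n).mem_nhds hu)).fderiv_eq

theorem exists_norm_le (hh : SmoothUpToBoundary h) :
    ∃ C : ℝ≥0, ∀ u ∈ unitCube n, ‖h u‖ ≤ C := by
  obtain ⟨W, hW, hWc, H, hH, he⟩ := hh
  obtain ⟨C, hC⟩ := (isCompact_closedUnitCube n).exists_bound_of_continuousOn
    (hH.continuousOn.mono hWc)
  refine ⟨C.toNNReal, fun u hu => ?_⟩
  rw [he hu]
  exact (hC u (unitCube_subset_closedUnitCube n hu)).trans (Real.le_coe_toNNReal C)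

theorem exists_lipschitzOnWith (hh : SmoothUpToBoundary h) :
    ∃ K : ℝ≥0, LipschitzOnWith K h (unitCube n) := by
  obtain ⟨K, hK⟩ := hh.fderiv.exists_norm_le
  exact ⟨K, (convex_unitCube n).lipschitzOnWith_of_nnnorm_fderiv_le
    (fun u hu => hh.differentiableAt hu) hK⟩

theorem add {h' : (Fin n → ℝ) → G} (hh : SmoothUpToBoundary h)
    (hh' : SmoothUpToBoundary h') : SmoothUpToBoundary fun u => h u + h' u :=
  (hh.prodMk hh').comp_left (c := fun p : G × G => p.1 + p.2) (by fun_prop)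

theorem smul {c : (Fin n → ℝ) → ℝ} (hc : SmoothUpToBoundary c)
    (hh : SmoothUpToBoundary h) : SmoothUpToBoundary fun u => c u • h u :=
  (hc.prodMk hh).comp_left (c := fun p : ℝ × G => p.1 • p.2) (by fun_prop)

theorem clm_apply {A : (Fin n → ℝ) → G →L[ℝ] G'} (hA : SmoothUpToBoundary A)
    (hh : SmoothUpToBoundary h) : SmoothUpToBoundary fun u => A u (h u) :=
  (hA.prodMk hh).comp_left (c := fun p : (G →L[ℝ] G') × G => p.1 p.2)
    (contDiff_fst.clm_apply contDiff_snd)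

theorem divergence {F : (Fin n → ℝ) → (Fin n → ℝ)} (hF : SmoothUpToBoundary F) :
    SmoothUpToBoundary (divergence F) := by
  have key : ∀ s : Finset (Fin n), SmoothUpToBoundary fun u =>
      ∑ i ∈ s, _root_.fderiv ℝ (fun w => F w i) u (Pi.single i 1) := by
    intro s
    classical
    induction s using Finset.induction_on with
    | empty => simpa using of_contDiff (n := n) (h := fun _ => (0 : ℝ)) contDiff_const
    | insert i s hi ih =>
      simp only [Finset.sum_insert hi]
      refine add ?_ ih
      have h1 : SmoothUpToBoundary fun w => F w i :=
        hF.comp_left (c := fun x : Fin n → ℝ => x i) (by fun_prop)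
      exact h1.fderiv.clm_apply (of_contDiff contDiff_const)
  exact key Finset.univ

theorem gammaFn {f : (Fin n → ℝ) → (Fin n → ℝ)} (hf : SmoothUpToBoundary f) (j : ℕ) :
    SmoothUpToBoundary (gammaFn f j) := by
  induction j with
  | zero => exact of_contDiff contDiff_const
  | succ j ih => exact (ih.smul hf).divergence

end SmoothUpToBoundary

theorem HasHolomorphicContinuation.smoothUpToBoundary {n : ℕ} {f : (Fin n → ℝ) → (Fin n → ℝ)}
    (hf : HasHolomorphicContinuation f) : SmoothUpToBoundary f := by
  obtain ⟨r, hr, g, hg, hgf⟩ := hf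
  have hcast : ContDiff ℝ (⊤ : ℕ∞) fun (u : Fin n → ℝ) (i : Fin n) => (u i : ℂ) := by
    refine contDiff_pi.2 fun i => ?_
    exact Complex.ofRealCLM.contDiff.comp (contDiff_apply ℝ ℝ i)
  have hopen : IsOpen (polydisk (n := n) r fun _ => 1 / 2) := by
    simp only [polydisk, Set.ofPred_forall]
    exact isOpen_iInter_of_finite fun i => isOpen_lt (by fun_prop) continuous_const
  have hsm := (hg.contDiffOn_of_finiteDimensional hopen).restrict_scalars ℝ
  refine ⟨(fun (u : Fin n → ℝ) (i : Fin n) => (u i : ℂ)) ⁻¹' polydisk r fun _ => 1 / 2,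
    hopen.preimage hcast.continuous, ?_, fun u i => (g (fun i => (u i : ℂ)) i).re, ?_, ?_⟩
  · intro u hu i
    have h1 : ((u i : ℂ) - 1 / 2) = ((u i - 1 / 2 : ℝ) : ℂ) := by push_cast; rfl
    simp only
    rw [h1, Complex.norm_real, Real.norm_eq_abs]
    refine lt_of_le_of_lt (abs_le.2 ⟨?_, ?_⟩) hr <;> linarith [(hu i).1, (hu i).2]
  · refine contDiffOn_pi.2 fun i => ?_
    have h2 := contDiffOn_pi.1 (hsm.comp hcast.contDiffOn (fun u hu => hu)) i
    exact Complex.reCLM.contDiff.comp_contDiffOn h2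
  · intro u hu
    ext i
    simp only [hgf u (unitCube_subset_closedUnitCube n hu), Complex.ofReal_re]

/-! ### The determinant near the identity -/

/-- The derivative of the determinant at the identity is the trace. -/
theorem hasFDerivAt_det_one {n : ℕ} :
    ∃ D : ((Fin n → ℝ) →L[ℝ] (Fin n → ℝ)) →L[ℝ] ℝ,
      HasFDerivAt (fun A : (Fin n → ℝ) →L[ℝ] (Fin n → ℝ) => A.det) D 1 ∧
      ∀ B, D B = ∑ i, B (Pi.single i 1) i := by
  have hdet : ∀ A : (Fin n → ℝ) →L[ℝ] (Fin n → ℝ),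
      A.det = (LinearMap.toMatrix' (A : (Fin n → ℝ) →ₗ[ℝ] (Fin n → ℝ))).det := fun A => by
    rw [LinearMap.det_toMatrix']
  have hdiff : Differentiable ℝ fun A : (Fin n → ℝ) →L[ℝ] (Fin n → ℝ) => A.det := by
    simp only [hdet, Matrix.det_apply]
    refine Differentiable.fun_sum fun σ _ => Differentiable.const_smul ?_ _
    have hentry : ∀ i j, Differentiable ℝ fun A : (Fin n → ℝ) →L[ℝ] (Fin n → ℝ) =>
        LinearMap.toMatrix' (A : (Fin n → ℝ) →ₗ[ℝ] (Fin n → ℝ)) j i := by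
      intro i j
      simp only [LinearMap.toMatrix'_apply]
      have h1 : Differentiable ℝ fun A : (Fin n → ℝ) →L[ℝ] (Fin n → ℝ) =>
        A (Pi.single i 1) := by fun_prop
      exact differentiable_pi.1 h1 j
    fun_prop
  refine ⟨_, (hdiff 1).hasFDerivAt, fun B => ?_⟩
  have hline : HasDerivAt (fun r : ℝ => (1 : (Fin n → ℝ) →L[ℝ] (Fin n → ℝ)) + r • B) B 0 := by
    simpa using ((hasDerivAt_id (0 : ℝ)).smul_const B).const_add 1
  have h1 := HasFDerivAt.comp_hasDerivAt_of_eq (0 : ℝ) (hdiff 1).hasFDerivAt hline (by simp)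
  set M := LinearMap.toMatrix' (B : (Fin n → ℝ) →ₗ[ℝ] (Fin n → ℝ)) with hM
  have h2 : HasDerivAt (fun r : ℝ => (1 : Matrix (Fin n) (Fin n) ℝ).det + M.trace * r +
      (Matrix.det (1 + (Polynomial.X : Polynomial ℝ) • M.map Polynomial.C)).divX.divX.eval r
        * r ^ 2) M.trace 0 := by
    have h3 := (((hasDerivAt_id (0 : ℝ)).const_mul M.trace).const_add
      ((1 : Matrix (Fin n) (Fin n) ℝ).det)).add
      ((Polynomial.hasDerivAt (Matrix.det (1 + (Polynomial.X : Polynomial ℝ) •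
        M.map Polynomial.C)).divX.divX 0).mul (hasDerivAt_pow 2 (0 : ℝ)))
    convert! h3 using 1
    simp
  have h4 : (fun r : ℝ => ((1 : (Fin n → ℝ) →L[ℝ] (Fin n → ℝ)) + r • B).det) =
      fun r : ℝ => (1 : Matrix (Fin n) (Fin n) ℝ).det + M.trace * r +
      (Matrix.det (1 + (Polynomial.X : Polynomial ℝ) • M.map Polynomial.C)).divX.divX.eval r
        * r ^ 2 := by
    funext r
    rw [Matrix.det_one, ← Matrix.det_one_add_smul, hdet, hM]
    congr 1
    simp [LinearMap.toMatrix'_one]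
  have h5 := h1.unique (f := fun r : ℝ => ((1 : (Fin n → ℝ) →L[ℝ] (Fin n → ℝ)) + r • B).det)
    (h4 ▸ h2)
  rw [h5, Matrix.trace]
  refine Finset.sum_congr rfl fun i _ => ?_
  rw [Matrix.diag_apply, hM, LinearMap.toMatrix'_apply]
  congr 1

/-! ### Flows on the unit cube -/

/-- `ϕ t u` is the position at time `t` of the solution of `u̇ = f u` that starts at the point `u`
of the open unit cube; every such solution exists, and stays in the open cube, for all times. -/
structure IsCubeFlow {n : ℕ} (f : (Fin n → ℝ) → (Fin n → ℝ))
    (ϕ : ℝ → (Fin n → ℝ) → (Fin n → ℝ)) : Prop where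
  zero : ∀ u ∈ unitCube n, ϕ 0 u = u
  mem : ∀ t, ∀ u ∈ unitCube n, ϕ t u ∈ unitCube n
  hasDerivAt : ∀ u ∈ unitCube n, ∀ t, HasDerivAt (fun s => ϕ s u) (f (ϕ t u)) t

/-- Grönwall's inequality for global solutions of an autonomous equation, in both time
directions. -/
theorem dist_le_of_hasDerivAt_autonomous {E : Type*} [NormedAddCommGroup E] [NormedSpace ℝ E]
    {f : E → E} {U : Set E} {K : ℝ≥0} (hf : LipschitzOnWith K f U) {a b : ℝ → E}
    (ha : ∀ t, HasDerivAt a (f (a t)) t) (haU : ∀ t, a t ∈ U)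
    (hb : ∀ t, HasDerivAt b (f (b t)) t) (hbU : ∀ t, b t ∈ U) (t : ℝ) :
    dist (a t) (b t) ≤ dist (a 0) (b 0) * Real.exp (K * |t|) := by
  rcases le_total 0 t with ht | ht
  · have h := dist_le_of_trajectories_ODE_of_mem (v := fun _ => f) (s := fun _ => U) (K := K)
      (a := 0) (b := t) (f := a) (g := b) (fun _ _ => hf)
      (fun s _ => (ha s).continuousAt.continuousWithinAt) (fun s _ => (ha s).hasDerivWithinAt)
      (fun s _ => haU s)
      (fun s _ => (hb s).continuousAt.continuousWithinAt) (fun s _ => (hb s).hasDerivWithinAt)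
      (fun s _ => hbU s) le_rfl t ⟨ht, le_rfl⟩
    simpa [abs_of_nonneg ht] using h
  · have hrev : ∀ c : ℝ → E, (∀ t, HasDerivAt c (f (c t)) t) →
        ∀ t, HasDerivAt (fun s => c (-s)) (-f (c (-t))) t := fun c hc t => by
      simpa [Function.comp_def] using (hc (-t)).scomp t (hasDerivAt_neg t)
    have h := dist_le_of_trajectories_ODE_of_mem (v := fun _ x => -f x) (s := fun _ => U) (K := K)
      (a := 0) (b := -t) (f := fun s => a (-s)) (g := fun s => b (-s)) (fun _ _ => hf.neg)
      (fun s _ => (hrev a ha s).continuousAt.continuousWithinAt)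
      (fun s _ => (hrev a ha s).hasDerivWithinAt) (fun s _ => haU _)
      (fun s _ => (hrev b hb s).continuousAt.continuousWithinAt)
      (fun s _ => (hrev b hb s).hasDerivWithinAt)
      (fun s _ => hbU _) le_rfl (-t) ⟨by linarith, le_rfl⟩
    simpa [abs_of_nonpos ht] using h

theorem abs_le_of_mem_uIcc_zero {σ s : ℝ} (h : σ ∈ uIcc 0 s) : |σ| ≤ |s| := by
  have := abs_sub_left_of_mem_uIcc h
  rwa [sub_zero, sub_zero] at this

/-- The second-order Taylor estimate for a curve whose derivative is Lipschitz at `0`. -/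
theorem norm_sub_sub_smul_le_of_hasDerivAt {E : Type*} [NormedAddCommGroup E] [NormedSpace ℝ E]
    {c c' : ℝ → E} {C s : ℝ} (hC : 0 ≤ C) (hc : ∀ σ ∈ uIcc 0 s, HasDerivAt c (c' σ) σ)
    (hc' : ∀ σ ∈ uIcc 0 s, ‖c' σ - c' 0‖ ≤ C * |σ|) :
    ‖c s - c 0 - s • c' 0‖ ≤ C * s ^ 2 := by
  have h := Convex.norm_image_sub_le_of_norm_hasDerivWithin_le (s := uIcc 0 s)
    (f := fun σ => c σ - σ • c' 0) (f' := fun σ => c' σ - c' 0) (C := C * |s|) (x := 0) (y := s)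
    (fun σ hσ => by
      have h1 := ((hc σ hσ).sub ((hasDerivAt_id σ).smul_const (c' 0))).hasDerivWithinAt
        (s := uIcc 0 s)
      rwa [one_smul] at h1)
    (fun σ hσ => (hc' σ hσ).trans
      (mul_le_mul_of_nonneg_left (abs_le_of_mem_uIcc_zero hσ) hC))
    (convex_uIcc 0 s) left_mem_uIcc right_mem_uIcc
  simp only [zero_smul, sub_zero, Real.norm_eq_abs] at h
  rw [mul_assoc, abs_mul_abs_self, ← sq] at h
  rwa [sub_right_comm]

namespace IsCubeFlow

variable {n : ℕ} {f : (Fin n → ℝ) → (Fin n → ℝ)} {ϕ : ℝ → (Fin n → ℝ) → (Fin n → ℝ)}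

theorem dist_le (hϕ : IsCubeFlow f ϕ) {K : ℝ≥0} (hK : LipschitzOnWith K f (unitCube n))
    {u w : Fin n → ℝ} (hu : u ∈ unitCube n) (hw : w ∈ unitCube n) (t : ℝ) :
    dist (ϕ t u) (ϕ t w) ≤ dist u w * Real.exp (K * |t|) := by
  have := dist_le_of_hasDerivAt_autonomous hK (hϕ.hasDerivAt u hu) (fun t => hϕ.mem t u hu)
    (hϕ.hasDerivAt w hw) (fun t => hϕ.mem t w hw) t
  rwa [hϕ.zero u hu, hϕ.zero w hw] at this

theorem map_add (hϕ : IsCubeFlow f ϕ) (hf : SmoothUpToBoundary f) {u : Fin n → ℝ}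
    (hu : u ∈ unitCube n) (s t : ℝ) : ϕ s (ϕ t u) = ϕ (s + t) u := by
  obtain ⟨K, hK⟩ := hf.exists_lipschitzOnWith
  have := dist_le_of_hasDerivAt_autonomous hK (hϕ.hasDerivAt _ (hϕ.mem t u hu))
    (fun s => hϕ.mem s _ (hϕ.mem t u hu)) (b := fun s => ϕ (s + t) u)
    (fun s => (hϕ.hasDerivAt u hu (s + t)).comp_add_const s t)
    (fun s => hϕ.mem (s + t) u hu) s
  rw [hϕ.zero _ (hϕ.mem t u hu), zero_add, dist_self, zero_mul] at this
  exact dist_le_zero.1 this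

theorem injOn (hϕ : IsCubeFlow f ϕ) (hf : SmoothUpToBoundary f) (t : ℝ) :
    InjOn (ϕ t) (unitCube n) := by
  intro u hu w hw h
  rw [← hϕ.zero u hu, ← hϕ.zero w hw, ← neg_add_cancel t, ← hϕ.map_add hf hu, h,
    hϕ.map_add hf hw]

theorem image_image (hϕ : IsCubeFlow f ϕ) (hf : SmoothUpToBoundary f) {S : Set (Fin n → ℝ)}
    (hS : S ⊆ unitCube n) (s t : ℝ) : ϕ s '' (ϕ t '' S) = ϕ (s + t) '' S := by
  rw [Set.image_image]
  exact image_congr fun u hu => hϕ.map_add hf (hS hu) s t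

theorem image_subset (hϕ : IsCubeFlow f ϕ) {S : Set (Fin n → ℝ)}
    (hS : S ⊆ unitCube n) (t : ℝ) : ϕ t '' S ⊆ unitCube n := by
  rintro _ ⟨u, hu, rfl⟩
  exact hϕ.mem t u (hS hu)

theorem exists_lipschitzOnWith (hϕ : IsCubeFlow f ϕ) (hf : SmoothUpToBoundary f) (t : ℝ) :
    ∃ K : ℝ≥0, LipschitzOnWith K (ϕ t) (unitCube n) := by
  obtain ⟨K, hK⟩ := hf.exists_lipschitzOnWith
  refine ⟨(Real.exp (K * |t|)).toNNReal, LipschitzOnWith.of_dist_le_mul ?_⟩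
  intro u hu w hw
  rw [mul_comm, Real.coe_toNNReal _ (Real.exp_pos _).le]
  exact hϕ.dist_le hK hu hw t

theorem measurableSet_image (hϕ : IsCubeFlow f ϕ) (hf : SmoothUpToBoundary f)
    {S : Set (Fin n → ℝ)} (hS : S ⊆ unitCube n) (hSm : MeasurableSet S) (t : ℝ) :
    MeasurableSet (ϕ t '' S) := by
  obtain ⟨K, hK⟩ := hϕ.exists_lipschitzOnWith hf t
  exact hSm.image_of_continuousOn_injOn (hK.continuousOn.mono hS) ((hϕ.injOn hf t).mono hS)

/-- The derivative of a smooth function along the flow. -/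
theorem hasDerivAt_comp (hϕ : IsCubeFlow f ϕ) {G : Type*} [NormedAddCommGroup G]
    [NormedSpace ℝ G] {g : (Fin n → ℝ) → G} (hg : SmoothUpToBoundary g) {u : Fin n → ℝ}
    (hu : u ∈ unitCube n) (t : ℝ) :
    HasDerivAt (fun s => g (ϕ s u)) (fderiv ℝ g (ϕ t u) (f (ϕ t u))) t :=
  (hg.differentiableAt (hϕ.mem t u hu)).hasFDerivAt.comp_hasDerivAt t (hϕ.hasDerivAt u hu t)

/-- First-order expansion of a smooth function along the flow, uniform over the cube. -/
theorem exists_abs_comp_sub_le (hϕ : IsCubeFlow f ϕ) (hf : SmoothUpToBoundary f)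
    {g : (Fin n → ℝ) → ℝ} (hg : SmoothUpToBoundary g) :
    ∃ C : ℝ, 0 ≤ C ∧ ∀ s, ∀ u ∈ unitCube n,
      |g (ϕ s u) - g u - s * fderiv ℝ g u (f u)| ≤ C * s ^ 2 := by
  obtain ⟨M, hM⟩ := hf.exists_norm_le
  obtain ⟨L, hL⟩ := (hg.fderiv.clm_apply hf).exists_lipschitzOnWith
  refine ⟨L * M, by positivity, fun s u hu => ?_⟩
  have h := norm_sub_sub_smul_le_of_hasDerivAt (s := s) (C := L * M) (by positivity)
    (fun σ _ => hϕ.hasDerivAt_comp hg hu σ) (fun σ _ => ?_)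
  · simpa [hϕ.zero u hu] using h
  · have h1 := hL.norm_sub_le (hϕ.mem σ u hu) (hϕ.mem 0 u hu)
    have h2 := Convex.norm_image_sub_le_of_norm_hasDerivWithin_le (s := univ)
      (f := fun σ => ϕ σ u) (C := M) (x := 0) (y := σ)
      (fun τ _ => (hϕ.hasDerivAt u hu τ).hasDerivWithinAt) (fun τ _ => hM _ (hϕ.mem τ u hu))
      convex_univ (mem_univ _) (mem_univ _)
    rw [sub_zero, Real.norm_eq_abs] at h2
    calc _ ≤ L * ‖ϕ σ u - ϕ 0 u‖ := h1
      _ ≤ L * (M * |σ|) := by gcongr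
      _ = L * M * |σ| := by ring

/-- The remainder `ϕ s u - u - s • f u` of the first-order expansion of the flow is Lipschitz in the
initial point `u`, with a constant of order `s ^ 2`. This replaces the differentiability of the
flow in the initial point. -/
theorem exists_lipschitzOnWith_remainder (hϕ : IsCubeFlow f ϕ) (hf : SmoothUpToBoundary f) :
    ∃ C : ℝ≥0, ∀ s : ℝ, |s| ≤ 1 →
      LipschitzOnWith (C * ‖s‖₊ ^ 2) (fun u => ϕ s u - u - s • f u) (unitCube n) := by
  obtain ⟨K, hK⟩ := hf.exists_lipschitzOnWith
  obtain ⟨L, hL⟩ := (hf.fderiv.clm_apply hf).exists_lipschitzOnWith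
  refine ⟨L * (Real.exp K).toNNReal, fun s hs => ?_⟩
  rw [lipschitzOnWith_iff_norm_sub_le]
  intro u hu w hw
  have habs : ∀ σ ∈ uIcc 0 s, |σ| ≤ 1 := fun σ hσ =>
    (abs_le_of_mem_uIcc_zero hσ).trans hs
  have hC : 0 ≤ L * Real.exp K * ‖u - w‖ := by positivity
  have h := norm_sub_sub_smul_le_of_hasDerivAt (s := s)
    (c := fun σ => ϕ σ u - ϕ σ w) (c' := fun σ => f (ϕ σ u) - f (ϕ σ w)) hC
    (fun σ _ => (hϕ.hasDerivAt u hu σ).sub (hϕ.hasDerivAt w hw σ)) (fun σ hσ => ?_)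
  · simp only [hϕ.zero u hu, hϕ.zero w hw] at h
    calc _ = ‖ϕ s u - ϕ s w - (u - w) - s • (f u - f w)‖ := by
          rw [smul_sub]; congr 1; abel
      _ ≤ _ := h
      _ = _ := by
        push_cast
        rw [Real.norm_eq_abs, sq_abs, Real.coe_toNNReal _ (Real.exp_pos _).le]
        ring
  · have h1 := Convex.norm_image_sub_le_of_norm_hasDerivWithin_le (s := uIcc 0 s)
      (f := fun σ => f (ϕ σ u) - f (ϕ σ w)) (C := L * Real.exp K * ‖u - w‖) (x := 0) (y := σ)
      (fun τ _ => ((hϕ.hasDerivAt_comp hf hu τ).sub (hϕ.hasDerivAt_comp hf hw τ)).hasDerivWithinAt)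
      (fun τ hτ => ?_) (convex_uIcc 0 s) left_mem_uIcc hσ
    · simpa using h1
    · have h2 := hL.norm_sub_le (hϕ.mem τ u hu) (hϕ.mem τ w hw)
      have h3 := hϕ.dist_le hK hu hw τ
      rw [dist_eq_norm, dist_eq_norm] at h3
      have h4 : Real.exp (K * |τ|) ≤ Real.exp K :=
        Real.exp_le_exp.2 (mul_le_of_le_one_right K.coe_nonneg (habs τ hτ))
      calc _ ≤ L * ‖ϕ τ u - ϕ τ w‖ := h2
        _ ≤ L * (‖u - w‖ * Real.exp K) := by
          gcongr
          exact h3.trans (by gcongr)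
        _ = L * Real.exp K * ‖u - w‖ := by ring

end IsCubeFlow

/-! ### The transport theorem -/

theorem SmoothUpToBoundary.integrableOn {n : ℕ} {g : (Fin n → ℝ) → ℝ} (hg : SmoothUpToBoundary g)
    {S : Set (Fin n → ℝ)} (hS : S ⊆ unitCube n) : IntegrableOn g S := by
  obtain ⟨C, hC⟩ := hg.exists_norm_le
  have hcont : ContinuousOn g (unitCube n) := fun u hu =>
    (hg.differentiableAt hu).continuousAt.continuousWithinAt
  have hm := (isOpen_unitCube n).measurableSet
  refine IntegrableOn.mono_set ?_ hS
  refine IntegrableOn.of_bound (by simp [volume_unitCube]) (hcont.aestronglyMeasurable hm) C ?_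
  exact (ae_restrict_iff' hm).2 (Filter.Eventually.of_forall hC)

theorem divergence_smul {n : ℕ} {g : (Fin n → ℝ) → ℝ} {f : (Fin n → ℝ) → (Fin n → ℝ)}
    {u : Fin n → ℝ} (hg : DifferentiableAt ℝ g u) (hf : DifferentiableAt ℝ f u) :
    divergence (fun w => g w • f w) u = fderiv ℝ g u (f u) + g u * divergence f u := by
  have h1 : ∀ i, DifferentiableAt ℝ (fun w => f w i) u := differentiableAt_pi.1 hf
  have h2 : fderiv ℝ g u (f u) = ∑ i, f u i * fderiv ℝ g u (Pi.single i 1) := by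
    conv_lhs => rw [pi_eq_sum_univ' (f u), map_sum]
    simp
  rw [h2, divergence, divergence, Finset.mul_sum, ← Finset.sum_add_distrib]
  refine Finset.sum_congr rfl fun i _ => ?_
  simp only [Pi.smul_apply, smul_eq_mul]
  rw [fderiv_fun_mul hg (h1 i)]
  simp [add_comm]

/-- Lipschitz maps send null sets to null sets. -/
theorem LipschitzOnWith.volume_image_eq_zero {n : ℕ} {h : (Fin n → ℝ) → (Fin n → ℝ)}
    {S : Set (Fin n → ℝ)} {K : ℝ≥0} (hh : LipschitzOnWith K h S) (hS : volume S = 0) :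
    volume (h '' S) = 0 := by
  have h1 := hh.hausdorffMeasure_image_le (d := n) (by positivity)
  have h2 : (Measure.hausdorffMeasure n : Measure (Fin n → ℝ)) = volume := by
    simpa using hausdorffMeasure_pi_real (ι := Fin n)
  rw [h2, hS, mul_zero] at h1
  exact le_antisymm h1 zero_le

theorem eventually_mul_abs_lt (c : ℝ) {a : ℝ} (ha : 0 < a) :
    ∀ᶠ s in nhds (0 : ℝ), c * |s| < a := by
  have h1 : Continuous fun s : ℝ => c * |s| := by fun_prop
  have h2 : Filter.Tendsto (fun s : ℝ => c * |s|) (nhds 0) (nhds 0) := by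
    simpa using h1.tendsto 0
  exact h2.eventually (gt_mem_nhds ha)

namespace IsCubeFlow

variable {n : ℕ} {f : (Fin n → ℝ) → (Fin n → ℝ)} {ϕ : ℝ → (Fin n → ℝ) → (Fin n → ℝ)}

/-- Expansion of the Jacobian determinant of the flow for small times, uniform over the points
where the flow is differentiable. -/
theorem eventually_abs_det_sub_le (hϕ : IsCubeFlow f ϕ) (hf : SmoothUpToBoundary f) {ε : ℝ}
    (hε : 0 < ε) : ∀ᶠ s in nhds (0 : ℝ), ∀ u ∈ unitCube n, DifferentiableAt ℝ (ϕ s) u →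
      |(fderiv ℝ (ϕ s) u).det - 1 - s * divergence f u| ≤ ε * |s| := by
  obtain ⟨D, hD, hDtr⟩ := hasFDerivAt_det_one (n := n)
  obtain ⟨C, hC⟩ := hϕ.exists_lipschitzOnWith_remainder hf
  obtain ⟨L, hL⟩ := hf.fderiv.exists_norm_le
  set η : ℝ := ε / (2 * (L + C + 1)) with hη
  have hηpos : 0 < η := by positivity
  have h1 := (hasFDerivAt_iff_isLittleO.1 hD).def hηpos
  obtain ⟨r, hr, hdet⟩ := Metric.eventually_nhds_iff.1 h1
  filter_upwards [eventually_mul_abs_lt 1 one_pos, eventually_mul_abs_lt (L + C) hr,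
    eventually_mul_abs_lt (‖D‖ * C) (half_pos hε)]
    with s hs1 hsr hsD u hu hdiff
  rw [one_mul] at hs1
  set A := fderiv ℝ (ϕ s) u with hA
  -- The derivative of the remainder `ϕ s u - u - s • f u` is `A - 1 - s • fderiv ℝ f u`.
  have hB : ‖A - 1 - s • fderiv ℝ f u‖ ≤ C * |s| ^ 2 := by
    have h2 : HasFDerivAt (fun u => ϕ s u - u - s • f u) (A - 1 - s • fderiv ℝ f u) u :=
      (hdiff.hasFDerivAt.sub (hasFDerivAt_id u)).sub
        ((hf.differentiableAt hu).hasFDerivAt.const_smul s)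
    simpa using h2.le_of_lipschitzOn ((isOpen_unitCube n).mem_nhds hu) (hC s hs1.le)
  have hss : |s| ^ 2 ≤ |s| := by nlinarith [abs_nonneg s]
  have hA1 : ‖A - 1‖ ≤ (L + C) * |s| := by
    calc ‖A - 1‖ = ‖s • fderiv ℝ f u + (A - 1 - s • fderiv ℝ f u)‖ := by congr 1; abel
      _ ≤ ‖s • fderiv ℝ f u‖ + ‖A - 1 - s • fderiv ℝ f u‖ := norm_add_le _ _
      _ ≤ |s| * L + C * |s| ^ 2 := by
        rw [norm_smul, Real.norm_eq_abs]
        gcongr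
        exact hL u hu
      _ ≤ (L + C) * |s| := by nlinarith [C.coe_nonneg]
  have h3 := hdet (y := A) (by rw [dist_eq_norm]; exact hA1.trans_lt hsr)
  have h4 : D (A - 1) = s * divergence f u + D (A - 1 - s • fderiv ℝ f u) := by
    have h5 : D (fderiv ℝ f u) = divergence f u := by
      rw [hDtr, divergence]
      refine Finset.sum_congr rfl fun i _ => ?_
      rw [fderiv_apply (hf.differentiableAt hu)]
      rfl
    rw [map_sub D (A - 1), map_smul, h5, smul_eq_mul]
    ring
  have h6 : ‖D (A - 1 - s • fderiv ℝ f u)‖ ≤ ε / 2 * |s| := by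
    calc _ ≤ ‖D‖ * (C * |s| ^ 2) := (D.le_opNorm _).trans (by gcongr)
      _ = (‖D‖ * C * |s|) * |s| := by ring
      _ ≤ ε / 2 * |s| := by gcongr
  have h7 : η * ‖A - 1‖ ≤ ε / 2 * |s| := by
    calc η * ‖A - 1‖ ≤ η * ((L + C + 1) * |s|) := by
          gcongr
          exact hA1.trans (mul_le_mul_of_nonneg_right (by linarith) (abs_nonneg s))
      _ = ε / 2 * |s| := by rw [hη]; field_simp
  have hdet1 : (1 : (Fin n → ℝ) →L[ℝ] (Fin n → ℝ)).det = 1 := by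
    simp [ContinuousLinearMap.det]
  rw [hdet1, h4, Real.norm_eq_abs] at h3
  rw [Real.norm_eq_abs] at h6
  calc |A.det - 1 - s * divergence f u|
      = |(A.det - 1 - (s * divergence f u + D (A - 1 - s • fderiv ℝ f u))) +
          D (A - 1 - s • fderiv ℝ f u)| := by congr 1; ring
    _ ≤ η * ‖A - 1‖ + ε / 2 * |s| := (abs_add_le _ _).trans (add_le_add h3 h6)
    _ ≤ ε * |s| := by linarith

/-- Expansion of the integrand that the change of variables `ϕ s` produces. -/
theorem eventually_abs_density_sub_le (hϕ : IsCubeFlow f ϕ) (hf : SmoothUpToBoundary f)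
    {g : (Fin n → ℝ) → ℝ} (hg : SmoothUpToBoundary g) {ε : ℝ} (hε : 0 < ε) :
    ∀ᶠ s in nhds (0 : ℝ), ∀ u ∈ unitCube n, DifferentiableAt ℝ (ϕ s) u →
      |(|(fderiv ℝ (ϕ s) u).det| * g (ϕ s u)) - g u -
        s * divergence (fun w => g w • f w) u| ≤ ε * |s| := by
  obtain ⟨G, hG⟩ := hg.exists_norm_le
  obtain ⟨C, hC0, hC⟩ := hϕ.exists_abs_comp_sub_le hf hg
  obtain ⟨X, hX⟩ := (hg.fderiv.clm_apply hf).exists_norm_le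
  obtain ⟨M, hM⟩ := hf.divergence.exists_norm_le
  set η : ℝ := min (ε / (2 * (G + 1))) 1 with hη
  have hηpos : 0 < η := by positivity
  filter_upwards [eventually_mul_abs_lt 1 one_pos, hϕ.eventually_abs_det_sub_le hf hηpos,
    eventually_mul_abs_lt (M + 1) one_pos, eventually_mul_abs_lt (C + M * (X + C)) (half_pos hε)]
    with s hs1 hdet hsM hsC u hu hdiff
  rw [one_mul] at hs1
  have hd := hdet u hu hdiff
  have hg1 := hC s u hu
  have hGu : |g (ϕ s u)| ≤ G := hG _ (hϕ.mem s u hu)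
  have hXu : |fderiv ℝ g u (f u)| ≤ X := hX u hu
  have hMu : |divergence f u| ≤ M := hM u hu
  rw [divergence_smul (hg.differentiableAt hu) (hf.differentiableAt hu)]
  set d := divergence f u
  set x := fderiv ℝ g u (f u)
  set J := (fderiv ℝ (ϕ s) u).det
  have hsd : |s * d| ≤ M * |s| := by
    rw [abs_mul, mul_comm]; gcongr
  have hsx : |s * x| ≤ X * |s| := by
    rw [abs_mul, mul_comm]; gcongr
  have hss : s ^ 2 ≤ |s| := by rw [← sq_abs]; nlinarith [abs_nonneg s]
  -- For small times the flow preserves the orientation.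
  have hJ : 0 < J := by
    have h1 : η * |s| ≤ |s| := mul_le_of_le_one_left (abs_nonneg s) (min_le_right _ _)
    have h2 := (abs_le.1 hd).1
    have h3 := (abs_le.1 hsd).1
    nlinarith
  rw [abs_of_pos hJ]
  have hdiffg : |g (ϕ s u) - g u| ≤ (X + C) * |s| := by
    calc |g (ϕ s u) - g u| = |(g (ϕ s u) - g u - s * x) + s * x| := by congr 1; ring
      _ ≤ C * s ^ 2 + X * |s| := (abs_add_le _ _).trans (add_le_add hg1 hsx)
      _ ≤ (X + C) * |s| := by nlinarith
  have hηG : η * G ≤ ε / 2 := by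
    calc η * G ≤ ε / (2 * (G + 1)) * (G + 1) := by
          gcongr
          · exact min_le_left _ _
          · linarith
      _ = ε / 2 := by field_simp
  calc |J * g (ϕ s u) - g u - s * (x + g u * d)|
      = |(J - 1 - s * d) * g (ϕ s u) + ((g (ϕ s u) - g u - s * x) +
          (s * d) * (g (ϕ s u) - g u))| := by congr 1; ring
    _ ≤ (η * |s|) * G + (C * s ^ 2 + (M * |s|) * ((X + C) * |s|)) := by
        refine (abs_add_le _ _).trans (add_le_add ?_ ((abs_add_le _ _).trans (add_le_add hg1 ?_)))
        · rw [abs_mul]; gcongr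
        · rw [abs_mul]; gcongr
    _ = (η * G) * |s| + ((C + M * (X + C)) * |s|) * |s| := by rw [← sq_abs]; ring
    _ ≤ ε / 2 * |s| + ε / 2 * |s| := by gcongr
    _ = ε * |s| := by ring

/-- Change of variables along the flow. By Rademacher's theorem the flow, being Lipschitz, is
differentiable almost everywhere. -/
theorem setIntegral_image_eq (hϕ : IsCubeFlow f ϕ) (hf : SmoothUpToBoundary f)
    {g : (Fin n → ℝ) → ℝ} (hg : SmoothUpToBoundary g) {S : Set (Fin n → ℝ)}
    (hS : S ⊆ unitCube n) (hSm : MeasurableSet S) (s : ℝ) :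
    (∀ᵐ u ∂volume.restrict S, DifferentiableAt ℝ (ϕ s) u) ∧
    IntegrableOn (fun u => |(fderiv ℝ (ϕ s) u).det| * g (ϕ s u)) S ∧
    ∫ u in ϕ s '' S, g u = ∫ u in S, |(fderiv ℝ (ϕ s) u).det| * g (ϕ s u) := by
  obtain ⟨K, hK⟩ := hϕ.exists_lipschitzOnWith hf s
  have hae : ∀ᵐ u ∂(volume : Measure (Fin n → ℝ)), u ∈ S → DifferentiableAt ℝ (ϕ s) u := by
    filter_upwards [hK.ae_differentiableWithinAt_of_mem (μ := volume)] with u hu huS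
    exact (hu (hS huS)).differentiableAt ((isOpen_unitCube n).mem_nhds (hS huS))
  have hDm : MeasurableSet {u | DifferentiableAt ℝ (ϕ s) u} :=
    measurableSet_of_differentiableAt ℝ (ϕ s)
  set S' := S ∩ {u | DifferentiableAt ℝ (ϕ s) u} with hS'
  have hS'S : S' ⊆ S := inter_subset_left
  have hnull : volume (S \ S') = 0 := by
    refine measure_mono_null ?_ (ae_iff.1 hae)
    rintro u ⟨hu, hu'⟩ h
    exact hu' ⟨hu, h hu⟩
  have hSae : (S' : Set (Fin n → ℝ)) =ᵐ[volume] S :=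
    (ae_eq_set.2 ⟨by simp [sdiff_eq_empty.2 hS'S], hnull⟩)
  have himae : (ϕ s '' S' : Set (Fin n → ℝ)) =ᵐ[volume] ϕ s '' S := by
    refine ae_eq_set.2 ⟨by simp [sdiff_eq_empty.2 (image_mono hS'S)], ?_⟩
    have hsub : ϕ s '' S \ ϕ s '' S' ⊆ ϕ s '' (S \ S') := by
      rintro _ ⟨⟨u, hu, rfl⟩, h⟩
      exact ⟨u, ⟨hu, fun hu' => h ⟨u, hu', rfl⟩⟩, rfl⟩
    refine measure_mono_null hsub ?_
    exact (hK.mono (sdiff_subset.trans hS)).volume_image_eq_zero hnull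
  have hfd : ∀ u ∈ S', HasFDerivWithinAt (ϕ s) (fderiv ℝ (ϕ s) u) S' u := fun u hu =>
    hu.2.hasFDerivAt.hasFDerivWithinAt
  have hinj : InjOn (ϕ s) S' := (hϕ.injOn hf s).mono (hS'S.trans hS)
  have hS'm : MeasurableSet S' := hSm.inter hDm
  refine ⟨(ae_restrict_iff' hSm).2 hae, ?_, ?_⟩
  · have h1 := (integrableOn_image_iff_integrableOn_abs_det_fderiv_smul volume hS'm hfd hinj g).1
      (hg.integrableOn (hϕ.image_subset (hS'S.trans hS) s))
    exact h1.congr_set_ae hSae.symm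
  · rw [← setIntegral_congr_set himae, ← setIntegral_congr_set hSae]
    exact integral_image_eq_integral_abs_det_fderiv_smul volume hS'm hfd hinj g

theorem hasDerivAt_setIntegral_image_zero (hϕ : IsCubeFlow f ϕ) (hf : SmoothUpToBoundary f)
    {g : (Fin n → ℝ) → ℝ} (hg : SmoothUpToBoundary g) {S : Set (Fin n → ℝ)}
    (hS : S ⊆ unitCube n) (hSm : MeasurableSet S) :
    HasDerivAt (fun s => ∫ u in ϕ s '' S, g u)
      (∫ u in S, divergence (fun w => g w • f w) u) 0 := by
  have hvol : volume.real S ≤ 1 := by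
    have := measureReal_mono (μ := volume) hS (by simp [volume_unitCube])
    simpa [measureReal_def, volume_unitCube] using this
  have hfin : volume S ≠ ⊤ :=
    ne_top_of_le_ne_top (by simp [volume_unitCube]) (measure_mono hS)
  have hid : ϕ 0 '' S = S := by
    rw [image_congr fun u hu => hϕ.zero u (hS hu), image_id']
  rw [hasDerivAt_iff_isLittleO, Asymptotics.isLittleO_iff]
  intro ε hε
  filter_upwards [hϕ.eventually_abs_density_sub_le hf hg hε] with s hs
  obtain ⟨hdiff, hint, heq⟩ := hϕ.setIntegral_image_eq hf hg hS hSm s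
  have hgi : IntegrableOn g S := hg.integrableOn hS
  have hdi : IntegrableOn (divergence fun w => g w • f w) S :=
    (hg.smul hf).divergence.integrableOn hS
  rw [hid, heq, sub_zero, smul_eq_mul, ← integral_sub hint hgi, ← integral_const_mul,
    ← integral_sub (hint.sub' hgi) (hdi.const_mul s)]
  calc _ ≤ ε * |s| * volume.real S := by
        refine norm_setIntegral_le_of_norm_le_const_ae' hfin.lt_top ?_
        filter_upwards [(ae_restrict_iff' hSm).1 hdiff] with u hu huS
        exact hs u (hS huS) (hu huS)
    _ ≤ ε * ‖s‖ := mul_le_of_le_one_right (by positivity) hvol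

/-- **Reynolds transport theorem** for the images of an arbitrary measurable set under the flow. -/
theorem hasDerivAt_setIntegral_image (hϕ : IsCubeFlow f ϕ) (hf : SmoothUpToBoundary f)
    {g : (Fin n → ℝ) → ℝ} (hg : SmoothUpToBoundary g) {S : Set (Fin n → ℝ)}
    (hS : S ⊆ unitCube n) (hSm : MeasurableSet S) (t : ℝ) :
    HasDerivAt (fun s => ∫ u in ϕ s '' S, g u)
      (∫ u in ϕ t '' S, divergence (fun w => g w • f w) u) t := by
  have h := hϕ.hasDerivAt_setIntegral_image_zero hf hg (hϕ.image_subset hS t)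
    (hϕ.measurableSet_image hf hS hSm t)
  rw [← sub_self t] at h
  have h1 := h.comp_sub_const t t
  refine h1.congr_of_eventuallyEq (Filter.Eventually.of_forall fun s => ?_)
  simp only [hϕ.image_image hf hS, sub_add_cancel]

end IsCubeFlow

/-! ### Derivatives of the volume and the Taylor remainder -/

/-- Iterating the transport theorem, starting from the constant density `Γ_0 = 1`. -/
theorem IsCubeFlow.iteratedDeriv_volume_image {n : ℕ} {f : (Fin n → ℝ) → (Fin n → ℝ)}
    {ϕ : ℝ → (Fin n → ℝ) → (Fin n → ℝ)} (hϕ : IsCubeFlow f ϕ) (hf : SmoothUpToBoundary f)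
    {S : Set (Fin n → ℝ)} (hS : S ⊆ unitCube n) (hSm : MeasurableSet S) (τ : ℝ) (j : ℕ) :
    iteratedDeriv j (fun t => volume.real (ϕ (t - τ) '' S)) =
      fun t => ∫ u in ϕ (t - τ) '' S, gammaFn f j u := by
  induction j with
  | zero =>
    funext t
    simp [gammaFn]
  | succ j ih =>
    rw [iteratedDeriv_succ, ih]
    funext t
    exact ((hϕ.hasDerivAt_setIntegral_image hf (hf.gammaFn j) hS hSm (t - τ)).comp_sub_const
      t τ).deriv

theorem IsCubeFlow.contDiff_volume_image {n : ℕ} {f : (Fin n → ℝ) → (Fin n → ℝ)}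
    {ϕ : ℝ → (Fin n → ℝ) → (Fin n → ℝ)} (hϕ : IsCubeFlow f ϕ) (hf : SmoothUpToBoundary f)
    {S : Set (Fin n → ℝ)} (hS : S ⊆ unitCube n) (hSm : MeasurableSet S) (τ : ℝ) :
    ContDiff ℝ (⊤ : ℕ∞) (fun t => volume.real (ϕ (t - τ) '' S)) := by
  refine contDiff_of_differentiable_iteratedDeriv fun j _ t => ?_
  rw [hϕ.iteratedDeriv_volume_image hf hS hSm]
  exact ((hϕ.hasDerivAt_setIntegral_image hf (hf.gammaFn j) hS hSm (t - τ)).comp_sub_const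
    t τ).differentiableAt

theorem taylorRemainder_self (V : ℝ → ℝ) (k : ℕ) (τ : ℝ) : taylorRemainder V k τ τ = 0 := by
  simp [taylorRemainder, taylorPoly, Finset.sum_range_succ']

/-- The Lagrange form of the remainder, to the left of the centre of expansion. -/
theorem exists_taylorRemainder_eq {V : ℝ → ℝ} {k : ℕ} (hV : ContDiff ℝ (k + 1) V) {τ t : ℝ}
    (h : t < τ) : ∃ s ∈ Ioo t τ, taylorRemainder V k τ t =
      iteratedDeriv (k + 1) V s * (t - τ) ^ (k + 1) / ((k + 1)! : ℝ) := by
  obtain ⟨s, hs, heq⟩ := taylor_mean_remainder_lagrange_iteratedDeriv (x := t) (x₀ := τ) h.ne'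
    hV.contDiffOn
  refine ⟨s, by rwa [uIoo_of_ge h.le] at hs, ?_⟩
  rw [← heq, taylorRemainder, taylorPoly, taylor_within_apply]
  congr 1
  refine Finset.sum_congr rfl fun j hj => ?_
  have hjk : ((j : ℕ) : WithTop ℕ∞) ≤ (k : WithTop ℕ∞) + 1 := by
    have : j ≤ k + 1 := (Finset.mem_range.1 hj).le
    exact_mod_cast this
  rw [iteratedDerivWithin_eq_iteratedDeriv (uniqueDiffOn_uIcc h.ne')
    ((hV.of_le hjk).contDiffAt) left_mem_uIcc, smul_eq_mul]
  ring

/-- By the Lagrange form of the remainder, a bound on `Γ_{k+1}` over a tube set bounds the Taylor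
remainder of the volume of the moving set. -/
theorem IsCubeFlow.taylorRemainder_volume_image_le {n : ℕ} {f : (Fin n → ℝ) → (Fin n → ℝ)}
    {ϕ : ℝ → (Fin n → ℝ) → (Fin n → ℝ)} (hϕ : IsCubeFlow f ϕ) (hf : SmoothUpToBoundary f)
    {S : Set (Fin n → ℝ)} (hS : S ⊆ unitCube n) (hSm : MeasurableSet S) {τ t : ℝ} (ht : t ≤ τ) (k : ℕ)
    {𝓡 : Set (Fin n → ℝ)} (h𝓡 : IsTube (fun s => ϕ (s - τ) '' S) t τ 𝓡) {δ : ℝ} (hδ : 0 ≤ δ)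
    (hbd : ∀ u ∈ 𝓡, (-1) ^ (k + 1) * gammaFn f (k + 1) u ≤ δ) :
    taylorRemainder (fun s => volume.real (ϕ (s - τ) '' S)) k τ t ≤
      δ * volume.real 𝓡 * (|t - τ| ^ (k + 1) / ((k + 1)! : ℝ)) := by
  rcases ht.eq_or_lt with rfl | ht
  · rw [taylorRemainder_self]
    positivity
  have hfin : volume 𝓡 ≠ ⊤ :=
    ne_top_of_le_ne_top (by simp [volume_unitCube]) (measure_mono h𝓡.1)
  obtain ⟨s, hs, heq⟩ := exists_taylorRemainder_eq (k := k)
    ((hϕ.contDiff_volume_image hf hS hSm τ).of_le (by exact_mod_cast le_top)) ht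
  have hΩ : ϕ (s - τ) '' S ⊆ 𝓡 := h𝓡.2 s ⟨hs.1.le, hs.2.le⟩
  have hint : ∫ u in ϕ (s - τ) '' S, (-1) ^ (k + 1) * gammaFn f (k + 1) u ≤
      δ * volume.real 𝓡 := by
    calc _ ≤ ∫ _ in ϕ (s - τ) '' S, δ := by
          refine setIntegral_mono_on ?_ ?_ (hϕ.measurableSet_image hf hS hSm _)
            fun u hu => hbd u (hΩ hu)
          · exact ((hf.gammaFn (k + 1)).integrableOn (hΩ.trans h𝓡.1)).const_mul _
          · exact integrableOn_const (ne_top_of_le_ne_top hfin (measure_mono hΩ))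
      _ = δ * volume.real (ϕ (s - τ) '' S) := by
          rw [setIntegral_const, smul_eq_mul, mul_comm]
      _ ≤ δ * volume.real 𝓡 := by
          gcongr
  -- Since `t < τ`, the sign of the Lagrange remainder is the sign `(-1) ^ (k + 1)` in the bound.
  have hsign : (t - τ) ^ (k + 1) = (-1) ^ (k + 1) * |t - τ| ^ (k + 1) := by
    rw [abs_of_neg (sub_neg.2 ht), ← mul_pow]
    ring
  rw [integral_const_mul] at hint
  rw [heq, hϕ.iteratedDeriv_volume_image hf hS hSm, hsign]
  calc _ = ((-1) ^ (k + 1) * ∫ u in ϕ (s - τ) '' S, gammaFn f (k + 1) u) *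
        (|t - τ| ^ (k + 1) / ((k + 1)! : ℝ)) := by ring
    _ ≤ _ := by gcongr

/-! ### The distribution function of a normal law as a change of coordinates -/

theorem continuous_gaussianPDFReal (a : ℝ) (v : ℝ≥0) : Continuous (gaussianPDFReal a v) := by
  unfold gaussianPDFReal
  fun_prop

theorem hasDerivAt_cdf_gaussianReal (a : ℝ) {v : ℝ≥0} (hv : v ≠ 0) (x : ℝ) :
    HasDerivAt (cdf (gaussianReal a v)) (gaussianPDFReal a v x) x := by
  have hint := integrable_gaussianPDFReal a v
  have hcdf : ∀ y, cdf (gaussianReal a v) y =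
      (∫ z in Iic 0, gaussianPDFReal a v z) + ∫ z in (0 : ℝ)..y, gaussianPDFReal a v z := by
    intro y
    rw [← intervalIntegral.integral_Iic_sub_Iic hint.integrableOn hint.integrableOn,
      add_sub_cancel, cdf_eq_real, measureReal_def, gaussianReal_apply_eq_integral a hv,
      ENNReal.toReal_ofReal]
    exact integral_nonneg fun z => gaussianPDFReal_nonneg a v z
  have h := (intervalIntegral.integral_hasDerivAt_right
    (hint.intervalIntegrable (a := 0) (b := x))
    (stronglyMeasurable_gaussianPDFReal a v).stronglyMeasurableAtFilter
    (continuous_gaussianPDFReal a v).continuousAt).const_add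
      (∫ z in Iic 0, gaussianPDFReal a v z)
  exact h.congr_of_eventuallyEq (Filter.Eventually.of_forall hcdf)

theorem strictMono_cdf_gaussianReal (a : ℝ) {v : ℝ≥0} (hv : v ≠ 0) :
    StrictMono (cdf (gaussianReal a v)) :=
  strictMono_of_hasDerivAt_pos (fun x => hasDerivAt_cdf_gaussianReal a hv x)
    fun x => gaussianPDFReal_pos a v x hv

theorem continuous_cdf_gaussianReal (a : ℝ) {v : ℝ≥0} (hv : v ≠ 0) :
    Continuous (cdf (gaussianReal a v)) :=
  continuous_iff_continuousAt.2 fun x => (hasDerivAt_cdf_gaussianReal a hv x).continuousAt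

theorem range_cdf_gaussianReal (a : ℝ) {v : ℝ≥0} (hv : v ≠ 0) :
    range (cdf (gaussianReal a v)) = Ioo 0 1 := by
  have hmono := strictMono_cdf_gaussianReal a hv
  refine Subset.antisymm ?_ fun y hy => ?_
  · rintro _ ⟨x, rfl⟩
    exact ⟨(cdf_nonneg _ (x - 1)).trans_lt (hmono (by linarith)),
      (hmono (lt_add_one x)).trans_le (cdf_le_one _ _)⟩
  · obtain ⟨x₀, hx₀⟩ := ((tendsto_cdf_atBot (gaussianReal a v)).eventually
      (gt_mem_nhds hy.1)).exists
    obtain ⟨x₁, hx₁⟩ := ((tendsto_cdf_atTop (gaussianReal a v)).eventually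
      (lt_mem_nhds hy.2)).exists
    exact mem_range_of_exists_le_of_exists_ge (continuous_cdf_gaussianReal a hv)
      ⟨x₀, hx₀.le⟩ ⟨x₁, hx₁.le⟩

/-- The probability integral transform: the distribution function of a normal law carries that law
to the uniform law on the unit interval. -/
theorem map_cdf_gaussianReal (a : ℝ) {v : ℝ≥0} (hv : v ≠ 0) :
    (gaussianReal a v).map (cdf (gaussianReal a v)) = volume.restrict (Ioo 0 1) := by
  have hmeas := (continuous_cdf_gaussianReal a hv).measurable
  ext B hB
  rw [Measure.map_apply hmeas hB, Measure.restrict_apply hB, ← range_cdf_gaussianReal a hv,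
    ← image_preimage_eq_inter_range]
  have h := lintegral_image_eq_lintegral_abs_deriv_mul (hmeas hB)
    (fun x _ => (hasDerivAt_cdf_gaussianReal a hv x).hasDerivWithinAt)
    (strictMono_cdf_gaussianReal a hv).injective.injOn (fun _ => 1)
  rw [setLIntegral_one] at h
  rw [h, gaussianReal_apply a hv]
  refine lintegral_congr fun x => ?_
  rw [mul_one, abs_of_nonneg (gaussianPDFReal_nonneg a v x), gaussianPDF]

section CubeCoordinates

variable {n : ℕ} {m : Fin n → ℝ} {v : Fin n → ℝ≥0}

theorem continuous_cdfMap (hv : ∀ i, v i ≠ 0) : Continuous (cdfMap m v) :=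
  continuous_pi fun i => (continuous_cdf_gaussianReal (m i) (hv i)).comp (continuous_apply i)

theorem injective_cdfMap (hv : ∀ i, v i ≠ 0) : Function.Injective (cdfMap m v) :=
  fun _ _ h => funext fun i => (strictMono_cdf_gaussianReal (m i) (hv i)).injective (congrFun h i)

theorem range_cdfMap (hv : ∀ i, v i ≠ 0) : range (cdfMap m v) = unitCube n := by
  refine Subset.antisymm ?_ fun u hu => ?_
  · rintro _ ⟨x, rfl⟩ i
    have : cdfMap m v x i ∈ range (cdf (gaussianReal (m i) (v i))) := ⟨x i, rfl⟩
    rwa [range_cdf_gaussianReal _ (hv i)] at this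
  · have h : ∀ i, ∃ x, cdf (gaussianReal (m i) (v i)) x = u i := fun i => by
      have : u i ∈ Ioo (0 : ℝ) 1 := hu i
      rwa [← range_cdf_gaussianReal (m i) (hv i)] at this
    choose x hx using h
    exact ⟨x, funext hx⟩

theorem cdfMap_mem (hv : ∀ i, v i ≠ 0) (x : Fin n → ℝ) : cdfMap m v x ∈ unitCube n :=
  range_cdfMap (m := m) hv ▸ mem_range_self x

theorem map_cdfMap_diagGaussian (hv : ∀ i, v i ≠ 0) :
    (diagGaussian m v).map (cdfMap m v) = volume.restrict (unitCube n) := by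
  have : ∀ i, SigmaFinite ((gaussianReal (m i) (v i)).map (cdf (gaussianReal (m i) (v i)))) :=
    fun i => by rw [map_cdf_gaussianReal _ (hv i)]; infer_instance
  have h := Measure.pi_map_pi (μ := fun i => gaussianReal (m i) (v i))
    (f := fun i => cdf (gaussianReal (m i) (v i)))
    (fun i => (continuous_cdf_gaussianReal (m i) (hv i)).aemeasurable)
  simp only [map_cdf_gaussianReal _ (hv _)] at h
  rw [unitCube_eq_pi, volume_pi, Measure.restrict_pi_pi, ← h]
  rfl

/-- The normal law of a set of states is the volume of its image in the unit cube. -/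
theorem volume_image_cdfMap (hv : ∀ i, v i ≠ 0) {A : Set (Fin n → ℝ)}
    (hA : MeasurableSet (cdfMap m v '' A)) :
    volume (cdfMap m v '' A) = diagGaussian m v A := by
  have hsub : cdfMap m v '' A ⊆ unitCube n := by
    rintro _ ⟨x, _, rfl⟩
    exact cdfMap_mem hv x
  rw [← Measure.restrict_eq_self volume hsub, ← map_cdfMap_diagGaussian (m := m) hv,
    Measure.map_apply (continuous_cdfMap hv).measurable hA,
    preimage_image_eq _ (injective_cdfMap hv)]

/-! ### The flow in the coordinates of the unit cube -/

/-- The state-space flow `Φ` in the coordinates `u = ψ x`. Off the range of `ψ`, which is the open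
unit cube, the value is meaningless. -/
noncomputable def cubeFlow (m : Fin n → ℝ) (v : Fin n → ℝ≥0)
    (Φ : (Fin n → ℝ) → ℝ → (Fin n → ℝ)) (t : ℝ) (u : Fin n → ℝ) : Fin n → ℝ :=
  cdfMap m v (Φ (Function.invFun (cdfMap m v) u) t)

variable {f : (Fin n → ℝ) → (Fin n → ℝ)} {Φ : (Fin n → ℝ) → ℝ → (Fin n → ℝ)}

theorem cubeFlow_cdfMap (hv : ∀ i, v i ≠ 0) (t : ℝ) (x : Fin n → ℝ) :
    cubeFlow m v Φ t (cdfMap m v x) = cdfMap m v (Φ x t) := by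
  rw [cubeFlow, Function.leftInverse_invFun (injective_cdfMap hv) x]

/-- By the chain rule the marginal densities cancel against those in `stateField`. -/
theorem isCubeFlow_cubeFlow (hv : ∀ i, v i ≠ 0) (hΦ : IsFlowOf (stateField m v f) Φ) :
    IsCubeFlow f (cubeFlow m v Φ) where
  zero u hu := by
    rw [← range_cdfMap (m := m) hv] at hu
    obtain ⟨x, rfl⟩ := hu
    rw [cubeFlow_cdfMap hv, (hΦ x).1]
  mem t u _ := cdfMap_mem hv _
  hasDerivAt u hu t := by
    rw [← range_cdfMap (m := m) hv] at hu
    obtain ⟨x, rfl⟩ := hu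
    simp only [cubeFlow_cdfMap hv]
    refine hasDerivAt_pi.2 fun i => ?_
    have h := (hasDerivAt_cdf_gaussianReal (m i) (hv i) (Φ x t i)).comp t
      (hasDerivAt_pi.1 ((hΦ x).2 t) i)
    rw [stateField, mul_div_cancel₀ _ (gaussianPDFReal_pos (m i) (v i) _ (hv i)).ne'] at h
    exact h

/-- The control mass is the image of the target set under the flow run backwards from time `τ`. -/
theorem controlMass_eq_image_cubeFlow (hv : ∀ i, v i ≠ 0) (hf : SmoothUpToBoundary f)
    (hΦ : IsFlowOf (stateField m v f) Φ) (R : Set (Fin n → ℝ)) (τ t : ℝ) :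
    controlMass m v Φ R τ t = cubeFlow m v Φ (t - τ) '' (cdfMap m v '' R) := by
  have hϕ := isCubeFlow_cubeFlow hv hΦ
  refine Subset.antisymm ?_ ?_
  · rintro _ ⟨x, hx, rfl⟩
    refine ⟨_, ⟨_, hx, rfl⟩, ?_⟩
    rw [← cubeFlow_cdfMap hv, hϕ.map_add hf (cdfMap_mem hv x), sub_add_sub_cancel, sub_self,
      hϕ.zero _ (cdfMap_mem hv x)]
  · rintro _ ⟨_, ⟨y, hy, rfl⟩, rfl⟩
    have hmem := hϕ.mem (t - τ) _ (cdfMap_mem (m := m) hv y)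
    rw [← range_cdfMap (m := m) hv] at hmem
    obtain ⟨x, hx⟩ := hmem
    refine ⟨x, ?_, hx⟩
    have h : cdfMap m v (Φ x (τ - t)) = cdfMap m v y := by
      rw [← cubeFlow_cdfMap hv, hx, hϕ.map_add hf (cdfMap_mem hv y), sub_add_sub_cancel, sub_self,
        hϕ.zero _ (cdfMap_mem hv y)]
    change Φ x (τ - t) ∈ R
    rwa [injective_cdfMap hv h]

theorem IsHyperrectangle.measurableSet {R : Set (Fin n → ℝ)} (hR : IsHyperrectangle R) :
    MeasurableSet R := by
  obtain ⟨I, hI, rfl⟩ := hR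
  exact MeasurableSet.univ_pi fun i => (hI i).measurableSet

end CubeCoordinates

/-! ### Bounds for the volume and the probability -/

theorem theorem2 (n : ℕ) (m : Fin n → ℝ) (v : Fin n → ℝ≥0) (hv : ∀ i, v i ≠ 0)
    (f : (Fin n → ℝ) → (Fin n → ℝ)) (hbc : BoundaryConditions f)
    (hf : HasHolomorphicContinuation f)
    (Φ : (Fin n → ℝ) → ℝ → (Fin n → ℝ)) (hΦ : IsFlowOf (stateField m v f) Φ)
    (R : Set (Fin n → ℝ)) (hR : IsHyperrectangle R) (τ : ℝ) (hτ : 0 ≤ τ) (k : ℕ) :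
    ContDiff ℝ (k + 1) (volumeFn m v Φ R τ) ∧
    (∀ t ∈ Icc 0 τ, ∀ 𝓡 : Set (Fin n → ℝ), IsTube (controlMass m v Φ R τ) t τ 𝓡 →
      ∀ δ : ℝ, 0 ≤ δ → (∀ u ∈ 𝓡, (-1) ^ (k + 1) * gammaFn f (k + 1) u ≤ δ) →
        taylorRemainder (volumeFn m v Φ R τ) k τ t
          ≤ δ * volume.real 𝓡 * (|t - τ| ^ (k + 1) / ((k + 1)! : ℝ))) ∧
    (∀ 𝓡 : Set (Fin n → ℝ), IsTube (controlMass m v Φ R τ) 0 τ 𝓡 →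
      ∀ δ : ℝ, 0 ≤ δ → (∀ u ∈ 𝓡, (-1) ^ (k + 1) * gammaFn f (k + 1) u ≤ δ) →
        (diagGaussian m v).real {x | Φ x τ ∈ R}
          ≤ taylorPoly (volumeFn m v Φ R τ) k τ 0
            + δ * volume.real 𝓡 * (τ ^ (k + 1) / ((k + 1)! : ℝ))) := by
  have hsm := hf.smoothUpToBoundary
  have hϕ := isCubeFlow_cubeFlow hv hΦ
  have hS : cdfMap m v '' R ⊆ unitCube n := by
    rintro _ ⟨x, _, rfl⟩
    exact cdfMap_mem hv x
  have hSm : MeasurableSet (cdfMap m v '' R) :=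
    hR.measurableSet.image_of_continuousOn_injOn (continuous_cdfMap hv).continuousOn
      (injective_cdfMap hv).injOn
  have hΩ : controlMass m v Φ R τ =
      fun s => cubeFlow m v Φ (s - τ) '' (cdfMap m v '' R) :=
    funext fun s => controlMass_eq_image_cubeFlow hv hsm hΦ R τ s
  have hV : volumeFn m v Φ R τ =
      fun s => volume.real (cubeFlow m v Φ (s - τ) '' (cdfMap m v '' R)) :=
    funext fun s => by rw [volumeFn, hΩ]
  have hrem : ∀ t ∈ Icc 0 τ, ∀ 𝓡 : Set (Fin n → ℝ), IsTube (controlMass m v Φ R τ) t τ 𝓡 →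
      ∀ δ : ℝ, 0 ≤ δ → (∀ u ∈ 𝓡, (-1) ^ (k + 1) * gammaFn f (k + 1) u ≤ δ) →
        taylorRemainder (volumeFn m v Φ R τ) k τ t
          ≤ δ * volume.real 𝓡 * (|t - τ| ^ (k + 1) / ((k + 1)! : ℝ)) := by
    intro t ht 𝓡 h𝓡 δ hδ hbd
    rw [hΩ] at h𝓡
    rw [hV]
    exact hϕ.taylorRemainder_volume_image_le hsm hS hSm ht.2 k h𝓡 hδ hbd
  refine ⟨?_, hrem, fun 𝓡 h𝓡 δ hδ hbd => ?_⟩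
  · rw [hV]
    exact (hϕ.contDiff_volume_image hsm hS hSm τ).of_le (by exact_mod_cast le_top)
  · have hP : (diagGaussian m v).real {x | Φ x τ ∈ R} = volumeFn m v Φ R τ 0 := by
      have hmeas : MeasurableSet (controlMass m v Φ R τ 0) := by
        rw [hΩ]
        exact hϕ.measurableSet_image hsm hS hSm _
      rw [volumeFn, measureReal_def, measureReal_def, controlMass, volume_image_cdfMap hv hmeas,
        stateControlMass, sub_zero]
    have h := hrem 0 ⟨le_rfl, hτ⟩ 𝓡 h𝓡 δ hδ hbd
    rw [taylorRemainder, zero_sub, abs_neg, abs_of_nonneg hτ] at h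
    rw [hP]
    linarith
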